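/- **Setting.** $\log$ is the logarithm to base $2$. A formula on $n$ variables is a De Morgan formula: a tree with leaves labelled by variables and with gates AND, OR (fan-in 2) and NOT; its size is its number of leaves. It is evaluated on inputs in $\{0,u,1\}^n$ by Kleene's three-valued logic. A resolution of $x\in\{0,u,1\}^n$ is a $y\in\{0,1\}^n$ that agrees with $x$ wherever $x_i\ne u$. A formula has a hazard at $x$ if it outputs $u$ at $x$ although it has one and the same Boolean value at all resolutions of $x$; it is hazard-free if it has no hazard. For $f:\{0,1\}^n\to\{0,1\}$ let $\mathrm{size}_F^u(f)$ be the minimal size of a hazard-free formula computing $f$, and $\mathrm{size}_F^+(f)$ the minimal size of a formula without NOT gates computing $f$ ($\infty$ if there is none). Let $\tilde f(x)=b\in\{0,1\}$ if $f(y)=b$ for all resolutions $y$ of $x$, and $\tilde f(x)=u$ otherwise. For $x,y\in\{0,1\}^n$ let $x+uy$ be $x$ with all coordinates $i$ such that $y_i=1$ replaced by $u$; the hazard-derivative $\mathrm{d}f(x;y)\in\{0,1\}$ is $1$ if $\tilde f(x+uy)=u$ and $0$ otherwise. A prime implicate of $f$ is a $p\in\{0,u,1\}^n$ with $\tilde f(p)=0$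 such that replacing any coordinate $p_i\neq u$ by $u$ makes the value of $\tilde f$ equal to $u$; $P_0^{(f)}$ is the set of prime implicates of $f$, and $P_0^{(f)}|_x$ is the set of those $p\in P_0^{(f)}$ of which $x\in\{0,1\}^n$ is a resolution. With high probability means with probability tending to $1$ as $n\to\infty$. **Theorem.** Let $f:\{0,1\}^n\to\{0,1\}$ be a uniformly random Boolean function. Then: 1. For every $\varepsilon>0$, with high probability $\mathrm{size}_F^u(f)\ \ge\ (1-\varepsilon)\,\dfrac{2^n}{\log n}$. 2. There is a sequence $\delta_n\ge 0$, $\delta_n\to 0$, such that with high probability $\mathrm{size}_F^u(f)\ \le\ 2^n\cdot n^{(1-\delta_n)\log n}$. 3. More sharply, there is a sequence $\delta_n\to 0$ such that with high probability $\mathrm{size}_F^u(f)\ \le\ 2^n\cdot \dfrac{n^{\log n}}{(\log n)^{(1-\delta_n)\log n}}$. 4. In particular $\mathrm{size}_F^u(f)=2^{(1+o(1))n}$ with high probability: there is a sequence $\delta_n\to0$ such that with high probability $2^{(1-\delta_n)n}\le \mathrm{size}_F^u(f)\le 2^{(1+\delta_n)n}$. 5. There is a sequence $\delta_n\to0$ such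 that with high probability the following holds for every set $X\subseteq\{0,1\}^n$ of minimal cardinality among the sets with $P_0^{(f)}=\bigcup_{x\in X}P_0^{(f)}|_x$: $$\Bigl(\sum_{x\in X}\mathrm{size}_F^+(\mathrm{d}f(x;\cdot))\Bigr)^{1-\delta_n}\ \le\ \mathrm{size}_F^u(f)\ \le\ \sum_{x\in X}\mathrm{size}_F^+(\mathrm{d}f(x;\cdot)).$$ -/

import Mathlib

open Filter Topology
open scoped ENNReal

namespace HazardFree

/-- Boolean functions on `n` variables. -/
abbrev BoolFun (n : ℕ) : Type := (Fin n → Bool) → Bool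

/-- The three values of Kleene logic: `some false` is 0, `some true` is 1 and `none` is the
unstable value u. -/
abbrev Ternary : Type := Option Bool

/-- The Kleene extension of the OR gate. -/
def Ternary.or : Ternary → Ternary → Ternary
  | some true, _ => some true
  | _, some true => some true
  | some false, some false => some false
  | _, _ => none

/-- The Kleene extension of the AND gate. -/
def Ternary.and : Ternary → Ternary → Ternary
  | some false, _ => some false
  | _, some false => some false
  | some true, some true => some true
  | _, _ => none

/-- The Kleene extension of the NOT gate. -/
def Ternary.not : Ternary → Ternary
  | some b => some (!b)
  | none => none

/-- A Boolean vector, seen as a (stable) ternary vector. -/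
def stable {n : ℕ} (y : Fin n → Bool) : Fin n → Ternary := fun i => some (y i)

/-- The order in which u lies below both 0 and 1 (and 0, 1 are incomparable), coordinatewise. -/
def LessStable {n : ℕ} (x y : Fin n → Ternary) : Prop := ∀ i, x i = none ∨ x i = y i

/-- The set `R(x)` of all resolutions of a ternary vector `x`. -/
def resolutions {n : ℕ} (x : Fin n → Ternary) : Set (Fin n → Bool) :=
  {y | LessStable x (stable y)}

/-- De Morgan formulas on `n` variables: the leaves are labelled with variables (there are no
constants), the gates are NOT, AND, OR. -/
inductive Formula (n : ℕ) : Type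
  | var : Fin n → Formula n
  | not : Formula n → Formula n
  | and : Formula n → Formula n → Formula n
  | or : Formula n → Formula n → Formula n

namespace Formula

variable {n : ℕ}

/-- The size of a formula: the number of its leaves. -/
def size : Formula n → ℕ
  | var _ => 1
  | not F => F.size
  | and F G => F.size + G.size
  | or F G => F.size + G.size

/-- The value of a formula at a ternary input. -/
def eval (x : Fin n → Ternary) : Formula n → Ternary
  | var i => x i
  | not F => Ternary.not (F.eval x)
  | and F G => Ternary.and (F.eval x) (G.eval x)
  | or F G => Ternary.or (F.eval x) (G.eval x)

/-- The formula has no negation gate. -/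
def IsMonotone : Formula n → Prop
  | var _ => True
  | not _ => False
  | and F G => F.IsMonotone ∧ G.IsMonotone
  | or F G => F.IsMonotone ∧ G.IsMonotone

/-- The formula computes the Boolean function `f`. -/
def Computes (F : Formula n) (f : BoolFun n) : Prop :=
  ∀ y : Fin n → Bool, F.eval (stable y) = some (f y)

/-- The formula has a hazard at `x`: it is constant on the resolutions of `x` and yet outputs u. -/
def HasHazardAt (F : Formula n) (x : Fin n → Ternary) : Prop :=
  F.eval x = none ∧ ∃ b : Bool, ∀ y ∈ resolutions x, F.eval (stable y) = some b

/-- The formula has no hazard. -/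
def IsHazardFree (F : Formula n) : Prop := ∀ x : Fin n → Ternary, ¬ F.HasHazardAt x

end Formula

/-- The minimal size of a hazard-free formula computing `f` (`⊤` if there is none, which happens
only for constant `f`). -/
noncomputable def hazardFreeSize {n : ℕ} (f : BoolFun n) : ℕ∞ :=
  ⨅ (F : Formula n) (_ : F.Computes f ∧ F.IsHazardFree), (F.size : ℕ∞)

/-- The minimal size of a monotone formula computing `f` (`⊤` if there is none, which happens
only if `f` is constant or not monotone). -/
noncomputable def monotoneSize {n : ℕ} (f : BoolFun n) : ℕ∞ :=
  ⨅ (F : Formula n) (_ : F.Computes f ∧ F.IsMonotone), (F.size : ℕ∞)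

open Classical in
/-- The hazard-free extension of `f`. -/
noncomputable def extension {n : ℕ} (f : BoolFun n) (x : Fin n → Ternary) : Ternary :=
  if ∀ y ∈ resolutions x, f y = false then some false
  else if ∀ y ∈ resolutions x, f y = true then some true
  else none

/-- The ternary vector `x + uy`: the coordinates `i` of `x` with `y i = 1` are made unstable. -/
def perturb {n : ℕ} (x y : Fin n → Bool) : Fin n → Ternary :=
  fun i => if y i then none else some (x i)

/-- The hazard-derivative `df(x; y)`: it is 1 if the hazard-free extension of `f` is u at `x + uy`,
and 0 otherwise (that is, if the extension still has the value `f x` there). -/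
noncomputable def hazardDerivative {n : ℕ} (f : BoolFun n) (x : Fin n → Bool) : BoolFun n :=
  fun y => decide (extension f (perturb x y) = none)

/-- The set of prime implicates of `f`. -/
def primeImplicates {n : ℕ} (f : BoolFun n) : Set (Fin n → Ternary) :=
  {p | extension f p = some false ∧
    ∀ i, p i ≠ none → extension f (Function.update p i none) = none}

/-- The prime implicates of `f` are the union over `x ∈ X` of those prime implicates that
derive `x`. -/
def Covers {n : ℕ} (f : BoolFun n) (X : Finset (Fin n → Bool)) : Prop :=
  primeImplicates f = ⋃ x ∈ X, {p ∈ primeImplicates f | LessStable p (stable x)}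

/-- A covering set of minimal size. -/
def IsMinimumCover {n : ℕ} (f : BoolFun n) (X : Finset (Fin n → Bool)) : Prop :=
  Covers f X ∧ ∀ Y : Finset (Fin n → Bool), Covers f Y → X.card ≤ Y.card

/-- The sum over `x ∈ X` of the monotone formula sizes of the hazard-derivatives `df(x; ·)`. -/
noncomputable def derivativeSum {n : ℕ} (f : BoolFun n) (X : Finset (Fin n → Bool)) : ℕ∞ :=
  ∑ x ∈ X, monotoneSize (hazardDerivative f x)

/-- The probability that a uniformly random Boolean function on `n` variables satisfies `P`. -/
noncomputable def uniformProb {n : ℕ} (P : BoolFun n → Prop) : ℝ :=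
  (Nat.card {f : BoolFun n // P f} : ℝ) / (Nat.card (BoolFun n) : ℝ)

/-- With high probability (as `n` tends to infinity), a uniformly random Boolean function on `n`
variables satisfies `P n`. -/
def WithHighProbability (P : (n : ℕ) → BoolFun n → Prop) : Prop :=
  Tendsto (fun n => uniformProb (P n)) atTop (𝓝 1)

end HazardFree

/-! The lower bound is a counting argument that uses only that a hazard-free formula computes `f`.
NOT gates cost no leaves and can be pushed down by De Morgan, so at most `(16 * n) ^ s` functions
have a formula with `s` leaves (`card_functionsOfSize_le_pow`). For `s` below `(1 - ε) * 2 ^ n / log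
n` this is a vanishing fraction of all `2 ^ 2 ^ n` functions.

The upper bound has a deterministic and a random half. Deterministically, let `X` cover the prime
implicates of `f`. Take a monotone formula for `df(x; ·)` at each zero `x ∈ X` of `f`, feed it `x ⊕
z`, and take the conjunction (`exists_hazardFree`). Monotone formulas read u pessimistically but
consistently, and this makes the conjunction output the right stable value wherever `f` is constant
on the resolutions of `z`. Hence `hazardFreeSize_le_derivativeSum`.

For random `f`, a union bound shows that no subcube of dimension about `log n` is monochromatic
(`whp_noLargeCube`). The zeros of `df(x; ·)` are the direction sets of monochromatic subcubes
through `x`, so each derivative has a monotone CNF with one clause per such small set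
(`monotoneSize_hazardDerivative_le`). Counting small sets bounds the derivative sum by `2 ^ n * n ^
6 * n ^ L / L ^ L` with `L = log n`, uniformly in `X`. This is `2 ^ ((1 + o(1)) * n)`, as is the
lower bound, so the sum is tight up to an exponent `1 - o(1)`. -/

namespace HazardFree

/-! ### Probability -/

section Probability

variable {n : ℕ}

open Classical in
theorem uniformProb_eq (P : BoolFun n → Prop) :
    uniformProb P = ((Finset.univ.filter P).card : ℝ) / 2 ^ 2 ^ n := by
  unfold uniformProb
  rw [Nat.card_eq_fintype_card, Nat.card_eq_fintype_card, Fintype.card_subtype]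
  simp

theorem uniformProb_mono {P Q : BoolFun n → Prop} (h : ∀ f, P f → Q f) :
    uniformProb P ≤ uniformProb Q := by
  classical
  rw [uniformProb_eq, uniformProb_eq]
  exact div_le_div_of_nonneg_right (Nat.cast_le.2 (Finset.card_le_card
    (Finset.monotone_filter_right _ fun f _ => h f))) (by positivity)

theorem uniformProb_true : uniformProb (fun _ : BoolFun n => True) = 1 := by
  classical
  rw [uniformProb_eq]
  simp

theorem uniformProb_not (P : BoolFun n → Prop) :
    uniformProb (fun f => ¬ P f) = 1 - uniformProb P := by
  classical
  rw [eq_sub_iff_add_eq, ← uniformProb_true (n := n)]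
  simp only [uniformProb_eq]
  rw [← add_div, add_comm, ← Nat.cast_add, Finset.card_filter_add_card_filter_not]
  simp

theorem uniformProb_exists_le {ι : Type*} [Fintype ι] (P : ι → BoolFun n → Prop) (c : ℝ)
    (h : ∀ i, uniformProb (P i) ≤ c) :
    uniformProb (fun f => ∃ i, P i f) ≤ Fintype.card ι * c := by
  classical
  calc uniformProb (fun f => ∃ i, P i f) ≤ ∑ i, uniformProb (P i) := by
        simp only [uniformProb_eq]
        rw [← Finset.sum_div, ← Nat.cast_sum]
        gcongr
        refine (Finset.card_le_card ?_).trans Finset.card_biUnion_le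
        intro f
        simp
    _ ≤ ∑ _i : ι, c := Finset.sum_le_sum fun i _ => h i
    _ = Fintype.card ι * c := by simp

theorem uniformProb_or_le (P Q : BoolFun n → Prop) :
    uniformProb (fun f => P f ∨ Q f) ≤ uniformProb P + uniformProb Q := by
  classical
  simp only [uniformProb_eq]
  rw [← add_div, ← Nat.cast_add]
  gcongr
  refine (Finset.card_le_card ?_).trans (Finset.card_union_le _ _)
  intro f
  simp

-- The functions with prescribed values on `T` form a product set with one choice on `T` and two
-- elsewhere. The product form avoids subtraction in the exponent.
open Classical in
theorem card_forall_eq_mul (T : Finset (Fin n → Bool)) (b : Bool) :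
    (Finset.univ.filter fun f : BoolFun n => ∀ z ∈ T, f z = b).card * 2 ^ T.card = 2 ^ 2 ^ n := by
  have h : (Finset.univ.filter fun f : BoolFun n => ∀ z ∈ T, f z = b)
      = Fintype.piFinset fun z => if z ∈ T then {b} else Finset.univ := by
    ext f
    simp only [Finset.mem_filter, Finset.mem_univ, true_and, Fintype.mem_piFinset]
    refine forall_congr' fun z => ?_
    by_cases hz : z ∈ T <;> simp [hz]
  rw [h, Fintype.card_piFinset]
  have h2 : ∀ z, (if z ∈ T then ({b} : Finset Bool) else Finset.univ).card
      = if z ∈ T then 1 else 2 := by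
    intro z
    split_ifs <;> simp
  simp only [h2]
  rw [Finset.prod_ite]
  simp only [Finset.prod_const, one_pow, one_mul]
  rw [← pow_add]
  congr 1
  have h3 := Finset.card_filter_add_card_filter_not (s := (Finset.univ : Finset (Fin n → Bool)))
    (fun z => z ∈ T)
  simp only [Finset.filter_univ_mem, Finset.card_univ, Fintype.card_pi, Fintype.card_bool,
    Finset.prod_const, Fintype.card_fin] at h3
  omega

theorem uniformProb_forall_eq (T : Finset (Fin n → Bool)) (b : Bool) :
    uniformProb (fun f : BoolFun n => ∀ z ∈ T, f z = b) = ((2 : ℝ) ^ T.card)⁻¹ := by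
  classical
  rw [uniformProb_eq, div_eq_iff (by positivity), eq_comm, inv_mul_eq_iff_eq_mul₀ (by positivity),
    mul_comm]
  have h := card_forall_eq_mul T b
  norm_cast
  convert h.symm

end Probability

theorem WithHighProbability.mono {P Q : (n : ℕ) → BoolFun n → Prop}
    (hP : WithHighProbability P) (h : ∀ᶠ n in atTop, ∀ f, P n f → Q n f) :
    WithHighProbability Q := by
  refine tendsto_of_tendsto_of_tendsto_of_le_of_le' hP tendsto_const_nhds ?_ ?_
  · filter_upwards [h] with n hn using uniformProb_mono hn
  · refine Eventually.of_forall fun n => ?_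
    rw [← uniformProb_true (n := n)]
    exact uniformProb_mono fun _ _ => trivial

theorem WithHighProbability.of_not_le {P : (n : ℕ) → BoolFun n → Prop} {b : ℕ → ℝ}
    (hb : Tendsto b atTop (𝓝 0)) (h : ∀ᶠ n in atTop, uniformProb (fun f => ¬ P n f) ≤ b n) :
    WithHighProbability P := by
  have hb' : Tendsto (fun n => 1 - b n) atTop (𝓝 1) := by
    simpa using tendsto_const_nhds.sub hb
  refine tendsto_of_tendsto_of_tendsto_of_le_of_le' hb' tendsto_const_nhds ?_ ?_
  · filter_upwards [h] with n hn
    rw [uniformProb_not] at hn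
    linarith
  · refine Eventually.of_forall fun n => ?_
    rw [← uniformProb_true (n := n)]
    exact uniformProb_mono fun _ _ => trivial

theorem WithHighProbability.and {P Q : (n : ℕ) → BoolFun n → Prop}
    (hP : WithHighProbability P) (hQ : WithHighProbability Q) :
    WithHighProbability fun n f => P n f ∧ Q n f := by
  have h : Tendsto (fun n => (1 - uniformProb (P n)) + (1 - uniformProb (Q n))) atTop (𝓝 0) := by
    simpa using (tendsto_const_nhds (x := (1 : ℝ)).sub hP).add
      (tendsto_const_nhds (x := (1 : ℝ)).sub hQ)
  refine .of_not_le h (Eventually.of_forall fun n => ?_)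
  rw [← uniformProb_not, ← uniformProb_not]
  refine le_trans (uniformProb_mono ?_) (uniformProb_or_le _ _)
  intro f hf
  tauto

/-! ### Monochromatic subcubes -/

section Subcubes

variable {n : ℕ}

/-- `f` is not constant on any subcube of dimension at least `m`. -/
def NoLargeCube (f : BoolFun n) (m : ℕ) : Prop :=
  ∀ (x : Fin n → Bool) (S : Finset (Fin n)), m ≤ S.card →
    ∃ z, (∀ i, i ∉ S → z i = x i) ∧ f z ≠ f x

theorem card_subcube (x : Fin n → Bool) (S : Finset (Fin n)) :
    (Fintype.piFinset fun i => if i ∈ S then Finset.univ else {x i}).card = 2 ^ S.card := by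
  rw [Fintype.card_piFinset]
  have h2 : ∀ i, (if i ∈ S then (Finset.univ : Finset Bool) else {x i}).card
      = if i ∈ S then 2 else 1 := by
    intro i
    split_ifs <;> simp
  simp only [h2]
  rw [Finset.prod_ite]
  simp

theorem mem_subcube {x z : Fin n → Bool} {S : Finset (Fin n)} :
    z ∈ (Fintype.piFinset fun i => if i ∈ S then Finset.univ else {x i}) ↔
      ∀ i, i ∉ S → z i = x i := by
  rw [Fintype.mem_piFinset]
  refine forall_congr' fun i => ?_
  by_cases hi : i ∈ S <;> simp [hi]

/-- Union bound over base point, direction set and colour, `2 ^ n * 2 ^ n * 2` triples; a given cube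
of dimension at least `m` has a given colour with probability at most `2 ^ (-2 ^ m)`. -/
theorem uniformProb_not_noLargeCube_le (m : ℕ) :
    uniformProb (fun f : BoolFun n => ¬ NoLargeCube f m)
      ≤ 2 * 4 ^ n * ((2 : ℝ) ^ 2 ^ m)⁻¹ := by
  have key : ∀ i : (Fin n → Bool) × Finset (Fin n) × Bool,
      uniformProb (fun f : BoolFun n =>
        m ≤ i.2.1.card ∧ ∀ z, (∀ j, j ∉ i.2.1 → z j = i.1 j) → f z = i.2.2)
        ≤ ((2 : ℝ) ^ 2 ^ m)⁻¹ := by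
    rintro ⟨x, S, b⟩
    by_cases hm : m ≤ S.card
    · refine (uniformProb_mono (Q := fun f => ∀ z ∈ (Fintype.piFinset fun i =>
        if i ∈ S then Finset.univ else {x i}), f z = b) ?_).trans ?_
      · exact fun f hf z hz => hf.2 z (mem_subcube.1 hz)
      · rw [uniformProb_forall_eq, card_subcube]
        gcongr <;> norm_num
    · simp only [hm, false_and]
      rw [show (fun _ : BoolFun n => False) = fun _ => ¬ True by simp, uniformProb_not,
        uniformProb_true]
      simp
  have h := uniformProb_exists_le _ _ key
  refine (uniformProb_mono ?_).trans (h.trans_eq ?_)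
  · intro f hf
    unfold NoLargeCube at hf
    push Not at hf
    obtain ⟨x, S, hS, hf⟩ := hf
    exact ⟨⟨x, S, f x⟩, hS, hf⟩
  · simp only [Fintype.card_prod, Fintype.card_pi, Fintype.card_bool, Finset.prod_const,
      Finset.card_univ, Fintype.card_fin, Fintype.card_finset]
    push_cast
    rw [show (4 : ℝ) = 2 * 2 by norm_num, mul_pow]
    ring

theorem whp_noLargeCube :
    WithHighProbability fun n f => NoLargeCube f (Nat.clog 2 n + 2) := by
  have h : Tendsto (fun n : ℕ => 2 * (1 / 4 : ℝ) ^ n) atTop (𝓝 0) := by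
    simpa using (tendsto_pow_atTop_nhds_zero_of_lt_one (r := (1 / 4 : ℝ)) (by norm_num)
      (by norm_num)).const_mul 2
  refine .of_not_le h (Eventually.of_forall fun n => ?_)
  refine (uniformProb_not_noLargeCube_le _).trans ?_
  -- The `+ 2` is chosen so that `2 ^ 2 ^ m` is at least `16 ^ n`, which beats the `4 ^ n` of the
  -- union bound.
  have h1 : 4 * n ≤ 2 ^ (Nat.clog 2 n + 2) := by
    have := Nat.le_pow_clog (b := 2) (by norm_num) n
    rw [pow_add]
    omega
  have h2 : (16 : ℝ) ^ n ≤ 2 ^ 2 ^ (Nat.clog 2 n + 2) := by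
    calc (16 : ℝ) ^ n = 2 ^ (4 * n) := by rw [pow_mul]; norm_num
      _ ≤ _ := pow_le_pow_right₀ (by norm_num) h1
  calc 2 * 4 ^ n * ((2 : ℝ) ^ 2 ^ (Nat.clog 2 n + 2))⁻¹ ≤ 2 * 4 ^ n * ((16 : ℝ) ^ n)⁻¹ := by
        gcongr
    _ = 2 * (1 / 4 : ℝ) ^ n := by
        rw [mul_assoc, ← inv_pow, ← mul_pow]
        norm_num

end Subcubes

/-! ### Kleene logic, resolutions and the hazard-free extension -/

theorem Ternary.and_eq_true {a b : Ternary} :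
    Ternary.and a b = some true ↔ a = some true ∧ b = some true := by
  rcases a with _ | _ | _ <;> rcases b with _ | _ | _ <;> simp [Ternary.and]

theorem Ternary.and_eq_false {a b : Ternary} :
    Ternary.and a b = some false ↔ a = some false ∨ b = some false := by
  rcases a with _ | _ | _ <;> rcases b with _ | _ | _ <;> simp [Ternary.and]

theorem Ternary.or_eq_true {a b : Ternary} :
    Ternary.or a b = some true ↔ a = some true ∨ b = some true := by
  rcases a with _ | _ | _ <;> rcases b with _ | _ | _ <;> simp [Ternary.or]

theorem Ternary.or_eq_false {a b : Ternary} :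
    Ternary.or a b = some false ↔ a = some false ∧ b = some false := by
  rcases a with _ | _ | _ <;> rcases b with _ | _ | _ <;> simp [Ternary.or]

section

variable {n : ℕ}

theorem mem_resolutions {x : Fin n → Ternary} {y : Fin n → Bool} :
    y ∈ resolutions x ↔ ∀ i, x i = none ∨ x i = some (y i) := Iff.rfl

theorem mem_resolutions_perturb {x y z : Fin n → Bool} :
    z ∈ resolutions (perturb x y) ↔ ∀ i, y i = false → z i = x i := by
  rw [mem_resolutions]
  refine forall_congr' fun i => ?_
  unfold perturb
  cases y i <;> simp [eq_comm]

theorem resolutions_nonempty (x : Fin n → Ternary) : (resolutions x).Nonempty :=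
  ⟨fun i => (x i).getD false, fun i => by
    unfold stable
    cases hi : x i <;> simp [hi]⟩

theorem resolutions_subset {p z : Fin n → Ternary} (h : LessStable p z) :
    resolutions z ⊆ resolutions p := by
  intro y hy i
  have h1 := h i
  have h2 := hy i
  unfold stable at *
  grind

theorem extension_eq_false {f : BoolFun n} {x : Fin n → Ternary} :
    extension f x = some false ↔ ∀ y ∈ resolutions x, f y = false := by
  unfold extension
  split_ifs <;> simp_all

theorem extension_eq_true {f : BoolFun n} {x : Fin n → Ternary} :
    extension f x = some true ↔ ∀ y ∈ resolutions x, f y = true := by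
  obtain ⟨y, hy⟩ := resolutions_nonempty x
  unfold extension
  split_ifs with h1 h2
  · simp only [Option.some.injEq, Bool.false_eq_true, false_iff, not_forall]
    exact ⟨y, hy, by simp [h1 y hy]⟩
  · simpa using h2
  · simpa using h2

/-- Since `x` itself resolves `x + uy`, the only stable value possible there is `f x`. -/
theorem hazardDerivative_eq_false {f : BoolFun n} {x y : Fin n → Bool} :
    hazardDerivative f x y = false ↔ ∀ z, (∀ i, y i = false → z i = x i) → f z = f x := by
  have hx : x ∈ resolutions (perturb x y) := mem_resolutions_perturb.2 fun _ _ => rfl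
  unfold hazardDerivative
  rw [decide_eq_false_iff_not]
  constructor
  · intro h z hz
    rw [← mem_resolutions_perturb] at hz
    rcases hb : extension f (perturb x y) with _ | _ | _
    · exact absurd hb h
    · rw [extension_eq_false] at hb
      rw [hb z hz, hb x hx]
    · rw [extension_eq_true] at hb
      rw [hb z hz, hb x hx]
  · intro h
    rcases hb : f x with _ | _
    · rw [extension_eq_false.2 fun z hz => (h z (mem_resolutions_perturb.1 hz)).trans hb]
      simp
    · rw [extension_eq_true.2 fun z hz => (h z (mem_resolutions_perturb.1 hz)).trans hb]
      simp

/-- Make stable coordinates unstable as long as the extension stays 0; the process ends at a prime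
implicate. The value cannot jump to 1, because the old resolutions remain resolutions. -/
theorem exists_primeImplicate {f : BoolFun n} {z : Fin n → Ternary}
    (hz : extension f z = some false) : ∃ p ∈ primeImplicates f, LessStable p z := by
  classical
  induction hc : (Finset.univ.filter fun i => z i ≠ none).card using Nat.strong_induction_on
    generalizing z with
  | _ c ih =>
    by_cases hp : z ∈ primeImplicates f
    · exact ⟨z, hp, fun i => Or.inr rfl⟩
    · have : ∃ i, z i ≠ none ∧ extension f (Function.update z i none) ≠ none := by
        by_contra! h
        exact hp ⟨hz, h⟩
      obtain ⟨i, hi, he⟩ := this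
      have hle : LessStable (Function.update z i none) z := fun j => by
        by_cases hj : j = i
        · subst hj; simp
        · simp [hj]
      have he' : extension f (Function.update z i none) = some false := by
        rcases hb : extension f (Function.update z i none) with _ | _ | _
        · exact absurd hb he
        · rfl
        · obtain ⟨y, hy⟩ := resolutions_nonempty z
          have h1 := extension_eq_true.1 hb y (resolutions_subset hle hy)
          rw [extension_eq_false.1 hz y hy] at h1
          cases h1
      have hlt : (Finset.univ.filter fun j => Function.update z i none j ≠ none).card < c := by
        rw [← hc]
        refine Finset.card_lt_card ((Finset.ssubset_iff_of_subset ?_).2 ⟨i, by simpa, by simp⟩)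
        intro j
        simp only [Finset.mem_filter, Finset.mem_univ, true_and]
        intro hj
        rcases hle j with h | h
        · exact absurd h hj
        · rwa [h] at hj
      obtain ⟨p, hp, hpz⟩ := ih _ hlt he' rfl
      refine ⟨p, hp, fun j => ?_⟩
      have h1 := hpz j
      have h2 := hle j
      grind

end

/-! ### Formulas -/

namespace Formula

variable {n : ℕ}

/-- The family must be nonempty since formulas have no constants. Outputs 0 and 1 are described
separately because u is neither. -/
theorem exists_inf {ι : Type*} (s : Finset ι) (hs : s.Nonempty) (F : ι → Formula n) :
    ∃ G : Formula n, G.size = ∑ i ∈ s, (F i).size ∧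
      ((∀ i ∈ s, (F i).IsMonotone) → G.IsMonotone) ∧
      ∀ x, (G.eval x = some true ↔ ∀ i ∈ s, (F i).eval x = some true) ∧
        (G.eval x = some false ↔ ∃ i ∈ s, (F i).eval x = some false) := by
  classical
  induction hs using Finset.Nonempty.cons_induction with
  | singleton a => exact ⟨F a, by simp⟩
  | cons a s ha hs ih =>
    obtain ⟨G, h1, h2, h3⟩ := ih
    refine ⟨(F a).and G, ?_, ?_, fun x => ⟨?_, ?_⟩⟩
    · simp [size, h1, Finset.sum_insert ha]
    · intro h
      exact ⟨h a (by simp), h2 fun i hi => h i (by simp [hi])⟩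
    · simp [eval, Ternary.and_eq_true, (h3 x).1]
    · simp [eval, Ternary.and_eq_false, (h3 x).2]

theorem exists_sup {ι : Type*} (s : Finset ι) (hs : s.Nonempty) (F : ι → Formula n) :
    ∃ G : Formula n, G.size = ∑ i ∈ s, (F i).size ∧
      ((∀ i ∈ s, (F i).IsMonotone) → G.IsMonotone) ∧
      ∀ x, (G.eval x = some true ↔ ∃ i ∈ s, (F i).eval x = some true) ∧
        (G.eval x = some false ↔ ∀ i ∈ s, (F i).eval x = some false) := by
  classical
  induction hs using Finset.Nonempty.cons_induction with
  | singleton a => exact ⟨F a, by simp⟩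
  | cons a s ha hs ih =>
    obtain ⟨G, h1, h2, h3⟩ := ih
    refine ⟨(F a).or G, ?_, ?_, fun x => ⟨?_, ?_⟩⟩
    · simp [size, h1, Finset.sum_insert ha]
    · intro h
      exact ⟨h a (by simp), h2 fun i hi => h i (by simp [hi])⟩
    · simp [eval, Ternary.or_eq_true, (h3 x).1]
    · simp [eval, Ternary.or_eq_false, (h3 x).2]

/-- The formula for `z ↦ F (x ⊕ z)` that negates the variables `i` with `x i = 1`. -/
def shift (x : Fin n → Bool) : Formula n → Formula n
  | var i => if x i then not (var i) else var i
  | not F => not (F.shift x)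
  | and F G => and (F.shift x) (G.shift x)
  | or F G => or (F.shift x) (G.shift x)

theorem size_shift (x : Fin n → Bool) (F : Formula n) : (F.shift x).size = F.size := by
  induction F with
  | var i => unfold shift; split_ifs <;> rfl
  | not F ih => simpa [shift, size] using ih
  | and F G hF hG => simp [shift, size, hF, hG]
  | or F G hF hG => simp [shift, size, hF, hG]

theorem eval_shift (x : Fin n → Bool) (z : Fin n → Ternary) (F : Formula n) :
    (F.shift x).eval z = F.eval fun i => if x i then Ternary.not (z i) else z i := by
  induction F with
  | var i => unfold shift; split_ifs with h <;> simp [eval, h]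
  | not F ih => simp [shift, eval, ih]
  | and F G hF hG => simp [shift, eval, hF, hG]
  | or F G hF hG => simp [shift, eval, hF, hG]

/-- Without negation, output 1 is tested by reading every u as 0, and dually output 0 by reading
every u as 1. Ternary evaluation thus reduces to the Boolean function computed. -/
theorem IsMonotone.eval_eq_true {F : Formula n} (hF : F.IsMonotone) (w : Fin n → Ternary) :
    F.eval w = some true ↔ F.eval (stable fun i => decide (w i = some true)) = some true := by
  induction F with
  | var i => simp [eval, stable]
  | not F ih => exact hF.elim
  | and F G ihF ihG => simp only [eval, Ternary.and_eq_true, ihF hF.1, ihG hF.2]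
  | or F G ihF ihG => simp only [eval, Ternary.or_eq_true, ihF hF.1, ihG hF.2]

theorem IsMonotone.eval_eq_false {F : Formula n} (hF : F.IsMonotone) (w : Fin n → Ternary) :
    F.eval w = some false ↔ F.eval (stable fun i => decide (w i ≠ some false)) = some false := by
  induction F with
  | var i => simp [eval, stable]
  | not F ih => exact hF.elim
  | and F G ihF ihG => simp only [eval, Ternary.and_eq_false, ihF hF.1, ihG hF.2]
  | or F G ihF ihG => simp only [eval, Ternary.or_eq_false, ihF hF.1, ihG hF.2]

theorem size_pos (F : Formula n) : 0 < F.size := by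
  induction F with
  | var i => exact Nat.one_pos
  | not F ih => exact ih
  | and F G hF hG => exact Nat.add_pos_left hF _
  | or F G hF hG => exact Nat.add_pos_left hF _

end Formula

/-! ### Hazard-free formulas from monotone formulas for hazard-derivatives -/

section

variable {n : ℕ}

open Formula

/-- A formula for `z ↦ df(x; x ⊕ z)` built from a monotone one for `df(x; ·)` is 0 exactly at those
`z` for which the largest subcube around `x` allowed by `z` is monochromatic. -/
theorem eval_shift_eq_false {f : BoolFun n} {x : Fin n → Bool} {F : Formula n}
    (hF : F.Computes (hazardDerivative f x)) (hm : F.IsMonotone) (z : Fin n → Ternary) :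
    (F.shift x).eval z = some false ↔ ∀ w : Fin n → Bool, (∀ i, z i = some (x i) → w i = x i) →
      f w = f x := by
  rw [eval_shift, hm.eval_eq_false, hF, Option.some.injEq, hazardDerivative_eq_false]
  refine forall_congr' fun w => imp_congr_left (forall_congr' fun i => imp_congr_left ?_)
  rcases z i with _ | _ | _ <;> cases x i <;> simp [Ternary.not]

/-- Here an unstable coordinate is read as agreeing with `x`, so only the coordinates where `z`
stably differs from `x` span the subcube. -/
theorem eval_shift_eq_true {f : BoolFun n} {x : Fin n → Bool} {F : Formula n}
    (hF : F.Computes (hazardDerivative f x)) (hm : F.IsMonotone) (z : Fin n → Ternary) :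
    (F.shift x).eval z = some true ↔ ∃ w : Fin n → Bool,
      (∀ i, z i = none ∨ z i = some (x i) → w i = x i) ∧ f w ≠ f x := by
  rw [eval_shift, hm.eval_eq_true, hF, Option.some.injEq, ← Bool.not_eq_false,
    hazardDerivative_eq_false]
  push Not
  refine exists_congr fun w => and_congr_left fun _ => forall_congr' fun i => imp_congr_left ?_
  rcases z i with _ | _ | _ <;> cases x i <;> simp [Ternary.not]

theorem exists_hazardFree {f : BoolFun n} {X : Finset (Fin n → Bool)} (hX : Covers f X)
    (hX0 : ∀ x ∈ X, f x = false) (hf : ∃ y, f y = false)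
    {F : (Fin n → Bool) → Formula n} (hF : ∀ x ∈ X, (F x).Computes (hazardDerivative f x))
    (hm : ∀ x ∈ X, (F x).IsMonotone) :
    ∃ G : Formula n, G.Computes f ∧ G.IsHazardFree ∧ G.size = ∑ x ∈ X, (F x).size := by
  have cover : ∀ z, extension f z = some false → ∃ p, ∃ x ∈ X,
      (∀ y ∈ resolutions p, f y = false) ∧ LessStable p z ∧ LessStable p (stable x) := by
    intro z hz
    obtain ⟨p, hp, hpz⟩ := exists_primeImplicate hz
    have hp' := hp
    rw [hX] at hp'
    simp only [Set.mem_iUnion, Set.mem_ofPred_eq] at hp'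
    obtain ⟨x, hx, _, hpx⟩ := hp'
    exact ⟨p, x, hx, extension_eq_false.1 hp.1, hpz, hpx⟩
  have hne : X.Nonempty := by
    obtain ⟨y, hy⟩ := hf
    obtain ⟨p, x, hx, -⟩ := cover (stable y) (extension_eq_false.2 fun w hw => by
      rwa [show w = y from funext fun i => by simpa [stable, eq_comm] using hw i])
    exact ⟨x, hx⟩
  obtain ⟨G, hsize, -, hG⟩ := Formula.exists_inf X hne fun x => (F x).shift x
  have zero : ∀ z, extension f z = some false → G.eval z = some false := by
    intro z hz
    obtain ⟨p, x, hx, hp, hpz, hpx⟩ := cover z hz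
    -- Where `p` is stable it agrees with both `z` and `x`, so `w` is forced to agree there too;
    -- thus `w` resolves `p`.
    refine (hG z).2.2 ⟨x, hx, (eval_shift_eq_false (hF x hx) (hm x hx) z).2 fun w hw => ?_⟩
    rw [hX0 x hx]
    refine hp w fun i => ?_
    have h1 := hpz i
    have h2 := hpx i
    have h3 := hw i
    unfold stable at *
    grind
  have one : ∀ z, extension f z = some true → G.eval z = some true := by
    intro z hz
    -- Filling the unstable coordinates of `z` from `x` gives a resolution of `z`, where `f` is 1,
    -- whereas `f x = 0`.
    refine (hG z).1.2 fun x hx => (eval_shift_eq_true (hF x hx) (hm x hx) z).2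
      ⟨fun i => (z i).getD (x i), fun i hi => ?_, ?_⟩
    · rcases hi with hi | hi <;> simp [hi]
    · rw [hX0 x hx, extension_eq_true.1 hz]
      · simp
      · intro i
        unfold stable
        cases hi : z i <;> simp [hi]
  have computes : G.Computes f := by
    intro y
    have hy : ∀ w ∈ resolutions (stable y), f w = f y := fun w hw => by
      rw [show w = y from funext fun i => by simpa [stable, eq_comm] using hw i]
    cases hb : f y with
    | false => exact zero _ (extension_eq_false.2 fun w hw => (hy w hw).trans hb)
    | true => exact one _ (extension_eq_true.2 fun w hw => (hy w hw).trans hb)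
  refine ⟨G, computes, ?_, ?_⟩
  · rintro z ⟨hz, b, hb⟩
    have hfb : ∀ y ∈ resolutions z, f y = b := fun y hy => by
      have := hb y hy
      rw [computes y] at this
      exact Option.some.inj this
    cases b with
    | false => rw [zero z (extension_eq_false.2 hfb)] at hz; cases hz
    | true => rw [one z (extension_eq_true.2 hfb)] at hz; cases hz
  · simpa [size_shift] using hsize

theorem exists_monotone_of_monotoneSize_ne_top {f : BoolFun n} (h : monotoneSize f ≠ ⊤) :
    ∃ F : Formula n, F.Computes f ∧ F.IsMonotone ∧ (F.size : ℕ∞) = monotoneSize f := by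
  unfold monotoneSize at h ⊢
  rw [iInf_subtype'] at h ⊢
  have : Nonempty {F : Formula n // F.Computes f ∧ F.IsMonotone} := by
    by_contra hne
    rw [not_nonempty_iff] at hne
    exact h (by simp)
  obtain ⟨⟨F, hF⟩, h'⟩ := ENat.exists_eq_iInf
    (fun F : {F : Formula n // F.Computes f ∧ F.IsMonotone} => (F.1.size : ℕ∞))
  exact ⟨F, hF.1, hF.2, h'⟩

theorem covers_univ (f : BoolFun n) : Covers f Finset.univ := by
  refine Set.ext fun p => ?_
  simp only [Finset.mem_univ, Set.iUnion_true, Set.mem_iUnion, Set.mem_ofPred_eq]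
  obtain ⟨x, hx⟩ := resolutions_nonempty p
  exact ⟨fun h => ⟨x, h, hx⟩, fun ⟨_, h, _⟩ => h⟩

/-- Every resolution of an implicate is a zero of `f`, so points with `f x = 1` cover nothing. -/
theorem Covers.filter_false {f : BoolFun n} {X : Finset (Fin n → Bool)} (hX : Covers f X) :
    Covers f (X.filter fun x => f x = false) := by
  unfold Covers at *
  refine Set.ext fun p => ?_
  rw [hX]
  simp only [Set.mem_iUnion, Set.mem_ofPred_eq, Finset.mem_filter]
  constructor
  · rintro ⟨x, hx, hp, hpx⟩
    exact ⟨x, ⟨hx, extension_eq_false.1 hp.1 x hpx⟩, ⟨x, hx, hp, hpx⟩, hpx⟩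
  · rintro ⟨x, ⟨hx, _⟩, hp, hpx⟩
    exact hp

theorem hazardFreeSize_le_derivativeSum {f : BoolFun n} {X : Finset (Fin n → Bool)}
    (hX : Covers f X) (hf : ∃ y, f y = false) : hazardFreeSize f ≤ derivativeSum f X := by
  classical
  have hle : derivativeSum f (X.filter fun x => f x = false) ≤ derivativeSum f X :=
    Finset.sum_le_sum_of_subset (Finset.filter_subset _ _)
  refine le_trans ?_ hle
  have hX' := hX.filter_false
  set Y := X.filter fun x => f x = false with hY
  by_cases htop : ∃ x ∈ Y, monotoneSize (hazardDerivative f x) = ⊤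
  · obtain ⟨x, hx, h⟩ := htop
    have : derivativeSum f Y = ⊤ := by
      refine top_le_iff.1 ?_
      rw [← h]
      exact Finset.single_le_sum (f := fun x => monotoneSize (hazardDerivative f x))
        (fun _ _ => zero_le) hx
    rw [this]
    exact le_top
  · push Not at htop
    have : ∀ x, ∃ F : Formula n, x ∈ Y → F.Computes (hazardDerivative f x) ∧ F.IsMonotone ∧
        (F.size : ℕ∞) = monotoneSize (hazardDerivative f x) := by
      intro x
      by_cases hx : x ∈ Y
      · obtain ⟨F, hF⟩ := exists_monotone_of_monotoneSize_ne_top (htop x hx)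
        exact ⟨F, fun _ => hF⟩
      -- Outside `Y` any formula will do. One exists because a zero of `f` yields a prime implicate,
      -- hence a point of `Y`.
      · obtain ⟨y, hy⟩ := hf
        obtain ⟨p, hp, _⟩ := exists_primeImplicate (f := f) (z := stable y)
          (extension_eq_false.2 fun w hw => by
            rwa [show w = y from funext fun i => by simpa [stable, eq_comm] using hw i])
        unfold Covers at hX'
        rw [hX'] at hp
        simp only [Set.mem_iUnion] at hp
        obtain ⟨x', hx', _⟩ := hp
        obtain ⟨F, _⟩ := exists_monotone_of_monotoneSize_ne_top (htop x' hx')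
        exact ⟨F, fun h => absurd h hx⟩
    choose F hF using this
    obtain ⟨G, hG, hG', hs⟩ := exists_hazardFree hX'
      (fun x hx => (Finset.mem_filter.1 hx).2) hf (fun x hx => (hF x hx).1)
      (fun x hx => (hF x hx).2.1)
    refine (iInf₂_le G ⟨hG, hG'⟩).trans_eq ?_
    rw [hs, derivativeSum, Nat.cast_sum]
    exact Finset.sum_congr rfl fun x hx => (hF x hx).2.2

end

/-! ### Counting formulas -/

section Counting

variable {n : ℕ}

theorem Formula.exists_computes (F : Formula n) : ∃ f, F.Computes f := by
  induction F with
  | var i => exact ⟨fun y => y i, fun y => rfl⟩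
  | not F ih =>
    obtain ⟨f, hf⟩ := ih
    exact ⟨fun y => !f y, fun y => by simp [Formula.eval, hf y, Ternary.not]⟩
  | and F G hF hG =>
    obtain ⟨f, hf⟩ := hF
    obtain ⟨g, hg⟩ := hG
    refine ⟨fun y => f y && g y, fun y => ?_⟩
    simp only [Formula.eval, hf y, hg y]
    cases f y <;> cases g y <;> rfl
  | or F G hF hG =>
    obtain ⟨f, hf⟩ := hF
    obtain ⟨g, hg⟩ := hG
    refine ⟨fun y => f y || g y, fun y => ?_⟩
    simp only [Formula.eval, hf y, hg y]
    cases f y <;> cases g y <;> rfl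

theorem Formula.Computes.eq_of_eval {F : Formula n} {f : BoolFun n} (hF : F.Computes f)
    {g : BoolFun n} (h : ∀ y, F.eval (stable y) = some (g y)) : f = g :=
  funext fun y => Option.some.inj ((hF y).symm.trans (h y))

open Classical in
/-- The Boolean functions computed by some formula with `s` leaves. -/
noncomputable def functionsOfSize (n s : ℕ) : Finset (BoolFun n) :=
  Finset.univ.filter fun f => ∃ F : Formula n, F.size = s ∧ F.Computes f

theorem mem_functionsOfSize {s : ℕ} {f : BoolFun n} :
    f ∈ functionsOfSize n s ↔ ∃ F : Formula n, F.size = s ∧ F.Computes f := by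
  simp [functionsOfSize]

theorem not_mem_functionsOfSize {s : ℕ} {f : BoolFun n} (h : f ∈ functionsOfSize n s) :
    (fun y => !f y) ∈ functionsOfSize n s := by
  obtain ⟨F, hs, hF⟩ := mem_functionsOfSize.1 h
  exact mem_functionsOfSize.2 ⟨F.not, hs, fun y => by simp [Formula.eval, hF y, Ternary.not]⟩

theorem Formula.eq_literal_of_size_eq_one (F : Formula n) (hs : F.size = 1) {f : BoolFun n}
    (hF : F.Computes f) : ∃ (i : Fin n) (b : Bool), f = fun y => xor (y i) b := by
  induction F generalizing f with
  | var i => exact ⟨i, false, hF.eq_of_eval fun y => by simp [eval, stable]⟩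
  | not F ih =>
    obtain ⟨g, hg⟩ := F.exists_computes
    obtain ⟨i, b, rfl⟩ := ih hs hg
    exact ⟨i, !b, hF.eq_of_eval fun y => by simp [eval, hg y, Ternary.not]⟩
  | and F G =>
    have := F.size_pos
    have := G.size_pos
    simp only [size] at hs
    omega
  | or F G =>
    have := F.size_pos
    have := G.size_pos
    simp only [size] at hs
    omega

/-- A NOT at the root is absorbed by De Morgan: both parts are negated at no cost in leaves, and the
two alternatives swap. The sizes `a + 1`, `b + 1` fit the Catalan recursion. -/
theorem Formula.exists_decomposition (F : Formula n) (hs : 2 ≤ F.size) {f : BoolFun n}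
    (hF : F.Computes f) : ∃ a b : ℕ, a + 1 + (b + 1) = F.size ∧ ∃ g ∈ functionsOfSize n (a + 1),
      ∃ h ∈ functionsOfSize n (b + 1),
        (f = fun y => g y && h y) ∨ (f = fun y => g y || h y) := by
  induction F generalizing f with
  | var i => simp [size] at hs
  | not F ih =>
    obtain ⟨f', hf'⟩ := F.exists_computes
    obtain ⟨a, b, hab, g, hg, h, hh, hgh⟩ := ih hs hf'
    refine ⟨a, b, hab, _, not_mem_functionsOfSize hg, _, not_mem_functionsOfSize hh, ?_⟩
    have hff' : f = fun y => !f' y := hF.eq_of_eval fun y => by simp [eval, hf' y, Ternary.not]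
    rcases hgh with rfl | rfl
    · right; simp [hff']
    · left; simp [hff']
  | and F G =>
    obtain ⟨f₁, h₁⟩ := F.exists_computes
    obtain ⟨f₂, h₂⟩ := G.exists_computes
    obtain ⟨a, ha⟩ := Nat.exists_eq_succ_of_ne_zero F.size_pos.ne'
    obtain ⟨b, hb⟩ := Nat.exists_eq_succ_of_ne_zero G.size_pos.ne'
    refine ⟨a, b, by simp [size, ha, hb], f₁, mem_functionsOfSize.2 ⟨F, ha, h₁⟩, f₂,
      mem_functionsOfSize.2 ⟨G, hb, h₂⟩, Or.inl (hF.eq_of_eval fun y => ?_)⟩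
    simp only [eval, h₁ y, h₂ y]
    cases f₁ y <;> cases f₂ y <;> rfl
  | or F G =>
    obtain ⟨f₁, h₁⟩ := F.exists_computes
    obtain ⟨f₂, h₂⟩ := G.exists_computes
    obtain ⟨a, ha⟩ := Nat.exists_eq_succ_of_ne_zero F.size_pos.ne'
    obtain ⟨b, hb⟩ := Nat.exists_eq_succ_of_ne_zero G.size_pos.ne'
    refine ⟨a, b, by simp [size, ha, hb], f₁, mem_functionsOfSize.2 ⟨F, ha, h₁⟩, f₂,
      mem_functionsOfSize.2 ⟨G, hb, h₂⟩, Or.inr (hF.eq_of_eval fun y => ?_)⟩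
    simp only [eval, h₁ y, h₂ y]
    cases f₁ y <;> cases f₂ y <;> rfl

/-- The factors count binary tree shapes, AND/OR labels of the `s` inner nodes, and literals at the
`s + 1` leaves. Functions are counted because NOT chains give infinitely many formulas of one size.
-/
theorem card_functionsOfSize_le (s : ℕ) :
    (functionsOfSize n (s + 1)).card ≤ catalan s * 2 ^ s * (2 * n) ^ (s + 1) := by
  classical
  induction s using Nat.strong_induction_on with
  | _ s ih =>
    rcases s with _ | s
    · have hsub : functionsOfSize n 1 ⊆ (Finset.univ : Finset (Fin n × Bool)).image
          fun p y => xor (y p.1) p.2 := by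
        intro f hf
        obtain ⟨F, hs, hF⟩ := mem_functionsOfSize.1 hf
        obtain ⟨i, b, rfl⟩ := F.eq_literal_of_size_eq_one hs hF
        exact Finset.mem_image.2 ⟨(i, b), Finset.mem_univ _, rfl⟩
      refine (Finset.card_le_card hsub).trans (Finset.card_image_le.trans ?_)
      simp [mul_comm]
    · have hsub : functionsOfSize n (s + 2) ⊆ (Finset.HasAntidiagonal.antidiagonal s).biUnion fun ij =>
          Finset.image₂ (fun g h y => g y && h y) (functionsOfSize n (ij.1 + 1))
              (functionsOfSize n (ij.2 + 1)) ∪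
            Finset.image₂ (fun g h y => g y || h y) (functionsOfSize n (ij.1 + 1))
              (functionsOfSize n (ij.2 + 1)) := by
        intro f hf
        obtain ⟨F, hs, hF⟩ := mem_functionsOfSize.1 hf
        obtain ⟨a, b, hab, g, hg, h, hh, hgh⟩ := F.exists_decomposition (by omega) hF
        refine Finset.mem_biUnion.2 ⟨(a, b), Finset.HasAntidiagonal.mem_antidiagonal.2 (by change a + b = s; omega), ?_⟩
        rcases hgh with rfl | rfl
        · exact Finset.mem_union_left _ (Finset.mem_image₂.2 ⟨g, hg, h, hh, rfl⟩)
        · exact Finset.mem_union_right _ (Finset.mem_image₂.2 ⟨g, hg, h, hh, rfl⟩)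
      refine (Finset.card_le_card hsub).trans (Finset.card_biUnion_le.trans ?_)
      rw [catalan_succ', Finset.sum_mul, Finset.sum_mul]
      refine Finset.sum_le_sum fun ij hij => ?_
      rw [Finset.HasAntidiagonal.mem_antidiagonal] at hij
      refine (Finset.card_union_le _ _).trans ?_
      have h1 := ih ij.1 (by omega)
      have h2 := ih ij.2 (by omega)
      have h3 := (Finset.card_image₂_le (fun (g h : BoolFun n) y => g y && h y)
        (functionsOfSize n (ij.1 + 1)) (functionsOfSize n (ij.2 + 1))).trans
          (Nat.mul_le_mul h1 h2)
      have h4 := (Finset.card_image₂_le (fun (g h : BoolFun n) y => g y || h y)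
        (functionsOfSize n (ij.1 + 1)) (functionsOfSize n (ij.2 + 1))).trans
          (Nat.mul_le_mul h1 h2)
      refine (Nat.add_le_add h3 h4).trans_eq ?_
      rw [← hij]
      ring

theorem card_functionsOfSize_le_pow (s : ℕ) : (functionsOfSize n s).card ≤ (16 * n) ^ s := by
  rcases s with _ | s
  · refine (Finset.card_eq_zero.2 ?_).trans_le (Nat.zero_le _)
    refine Finset.eq_empty_of_forall_notMem fun f hf => ?_
    obtain ⟨F, hs, -⟩ := mem_functionsOfSize.1 hf
    exact F.size_pos.ne' hs
  · refine (card_functionsOfSize_le s).trans ?_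
    have h : catalan s ≤ 4 ^ s := by
      refine le_trans ?_ (Nat.centralBinom_le_four_pow s)
      rw [← succ_mul_catalan_eq_centralBinom]
      exact Nat.le_mul_of_pos_left _ (Nat.succ_pos s)
    calc catalan s * 2 ^ s * (2 * n) ^ (s + 1) ≤ 4 ^ s * 2 ^ s * (2 * n) ^ (s + 1) := by gcongr
      _ = 2 * 16 ^ s * n ^ (s + 1) := by
        rw [mul_pow, show (16 : ℕ) = 4 * 2 * 2 by norm_num, mul_pow, mul_pow]
        ring
      _ ≤ 16 * 16 ^ s * n ^ (s + 1) := by gcongr; norm_num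
      _ = (16 * n) ^ (s + 1) := by ring

theorem uniformProb_hazardFreeSize_lt_le (hn : 0 < n) (r : ℝ) :
    uniformProb (fun f : BoolFun n => (hazardFreeSize f : ℝ≥0∞) < ENNReal.ofReal r)
      ≤ (16 * n : ℝ) ^ (⌊r⌋₊ + 1) / 2 ^ 2 ^ n := by
  classical
  rw [uniformProb_eq]
  gcongr
  have hsub : (Finset.univ.filter fun f : BoolFun n =>
      (hazardFreeSize f : ℝ≥0∞) < ENNReal.ofReal r) ⊆
        (Finset.range (⌊r⌋₊ + 1)).biUnion (functionsOfSize n) := by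
    intro f hf
    rw [Finset.mem_filter] at hf
    have hlt : hazardFreeSize f ≠ ⊤ := fun h => by
      rw [h] at hf
      simp at hf
    unfold hazardFreeSize at hf hlt
    rw [iInf_subtype'] at hf hlt
    have : Nonempty {F : Formula n // F.Computes f ∧ F.IsHazardFree} := by
      by_contra hne
      rw [not_nonempty_iff] at hne
      exact hlt (by simp)
    obtain ⟨⟨F, hF⟩, h'⟩ := ENat.exists_eq_iInf
      (fun F : {F : Formula n // F.Computes f ∧ F.IsHazardFree} => (F.1.size : ℕ∞))
    refine Finset.mem_biUnion.2 ⟨F.size, ?_, mem_functionsOfSize.2 ⟨F, rfl, hF.1⟩⟩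
    have h2 := hf.2
    rw [← h'] at h2
    simp only [ENat.toENNReal_coe] at h2
    rw [← ENNReal.ofReal_natCast, ENNReal.ofReal_lt_ofReal_iff'] at h2
    rw [Finset.mem_range, Nat.lt_succ_iff]
    exact Nat.le_floor h2.1.le
  have h : (Finset.univ.filter fun f : BoolFun n =>
      (hazardFreeSize f : ℝ≥0∞) < ENNReal.ofReal r).card ≤ (16 * n) ^ (⌊r⌋₊ + 1) :=
    calc _ ≤ ∑ s ∈ Finset.range (⌊r⌋₊ + 1), (16 * n) ^ s :=
          (Finset.card_le_card hsub).trans (Finset.card_biUnion_le.trans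
            (Finset.sum_le_sum fun s _ => card_functionsOfSize_le_pow s))
      _ ≤ _ := (Nat.geomSum_lt (by omega) fun k hk => Finset.mem_range.1 hk).le
  norm_cast
  convert h

end Counting

/-! ### The counting lower bound -/

theorem tendsto_logb_natCast : Tendsto (fun n : ℕ => Real.logb 2 n) atTop atTop :=
  (Real.tendsto_logb_atTop one_lt_two).comp tendsto_natCast_atTop_atTop

theorem logb_natCast_le (n : ℕ) : Real.logb 2 n ≤ n := by
  rcases Nat.eq_zero_or_pos n with rfl | hn
  · simp
  · rw [Real.logb_le_iff_le_rpow one_lt_two (by exact_mod_cast hn), Real.rpow_natCast]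
    exact_mod_cast n.lt_two_pow_self.le

theorem rpow_logb_natCast {n : ℕ} (hn : 0 < n) : (2 : ℝ) ^ Real.logb 2 n = n :=
  Real.rpow_logb two_pos (by norm_num) (by exact_mod_cast hn)

theorem whp_hazardFreeSize_ge {ε : ℝ} (hε : 0 < ε) :
    WithHighProbability fun n f =>
      ENNReal.ofReal ((1 - ε) * 2 ^ n / Real.logb 2 n) ≤ (hazardFreeSize f : ℝ≥0∞) := by
  have hb : Tendsto (fun n : ℕ => (2 : ℝ) ^ (4 + n - ε / 2 * 2 ^ n : ℝ)) atTop (𝓝 0) := by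
    refine (tendsto_rpow_atBot_of_base_gt_one 2 one_lt_two).comp ?_
    have h1 : Tendsto (fun n : ℕ => (2 : ℝ) ^ n * ((4 / 2 ^ n + n / 2 ^ n) - ε / 2)) atTop
        atBot := by
      refine Tendsto.atTop_mul_neg (C := (0 + 0) - ε / 2) (by linarith)
        (tendsto_pow_atTop_atTop_of_one_lt one_lt_two) ?_
      refine Tendsto.sub_const (Tendsto.add ?_ ?_) _
      · exact tendsto_const_nhds.div_atTop (tendsto_pow_atTop_atTop_of_one_lt one_lt_two)
      · simpa using tendsto_pow_const_div_const_pow_of_one_lt 1 (one_lt_two (α := ℝ))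
    refine h1.congr fun n => ?_
    field_simp
  refine .of_not_le hb ?_
  filter_upwards [eventually_gt_atTop 0, tendsto_logb_natCast.eventually_ge_atTop (8 / ε),
    tendsto_logb_natCast.eventually_ge_atTop 1] with n hn hL hL1
  set L := Real.logb 2 n with hLdef
  have hL0 : 0 < L := by linarith
  simp only [not_le]
  -- For `ε ≥ 1` the bound is nonpositive, so `ENNReal.ofReal` makes it 0.
  rcases le_or_gt 1 ε with h1 | h1
  · have : ENNReal.ofReal ((1 - ε) * 2 ^ n / L) = 0 :=
      ENNReal.ofReal_of_nonpos (div_nonpos_of_nonpos_of_nonneg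
        (mul_nonpos_of_nonpos_of_nonneg (by linarith) (by positivity)) hL0.le)
    simp only [this, not_lt_zero]
    rw [show (fun _ : BoolFun n => False) = fun _ => ¬ True by simp, uniformProb_not,
      uniformProb_true, sub_self]
    positivity
  · refine (uniformProb_hazardFreeSize_lt_le hn _).trans ?_
    set r := (1 - ε) * 2 ^ n / L with hr
    have hr0 : 0 ≤ r := by
      have : 0 ≤ 1 - ε := by linarith
      positivity
    have h16 : (16 * n : ℝ) = 2 ^ (4 + L) := by
      rw [Real.rpow_add two_pos, rpow_logb_natCast hn]
      norm_num
    calc (16 * n : ℝ) ^ (⌊r⌋₊ + 1) / 2 ^ 2 ^ n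
        = 2 ^ ((4 + L) * (⌊r⌋₊ + 1) - 2 ^ n : ℝ) := by
          rw [Real.rpow_sub two_pos, Real.rpow_mul two_pos.le, ← h16]
          norm_cast
      _ ≤ _ := by
        refine Real.rpow_le_rpow_of_exponent_le one_le_two ?_
        have h2 : (4 + L) * ((⌊r⌋₊ : ℝ) + 1) ≤ (4 + L) * (r + 1) := by
          gcongr
          exact Nat.floor_le hr0
        -- `L ≥ 8 / ε` makes the constant 4 cost at most a factor `1 + ε / 2`, and `(1 - ε) * (1 + ε
        -- / 2) ≤ 1 - ε / 2`.
        have h3 : (4 + L) * r ≤ (1 - ε / 2) * 2 ^ n := by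
          have h4 : (4 + L) * r = (1 - ε) * (4 / L + 1) * 2 ^ n := by
            rw [hr]; field_simp
          rw [h4]
          gcongr
          have h5 : 4 / L ≤ ε / 2 := by
            rw [div_le_iff₀ hL0]
            rw [div_le_iff₀ hε] at hL
            linarith
          have h6 : 0 ≤ 4 / L := by positivity
          nlinarith
        have h7 : L ≤ n := logb_natCast_le n
        linarith

/-! ### The conjunctive normal form of a hazard-derivative -/

section Derivatives

variable {n : ℕ}

theorem NoLargeCube.exists_eq_false {f : BoolFun n} {m : ℕ} (hf : NoLargeCube f m)
    (hm : m ≤ n) : ∃ y, f y = false := by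
  obtain ⟨z, -, hz⟩ := hf (fun _ => false) Finset.univ (by simpa using hm)
  rcases h : f z with _ | _
  · exact ⟨z, h⟩
  · exact ⟨fun _ => false, by rw [h] at hz; simpa using hz.symm⟩

-- The monotone CNF: each direction set `S` of a monochromatic subcube through `x` gives the clause
-- "some coordinate outside `S` is 1". Such `S` have fewer than `m` elements, and `m ≤ n` keeps
-- every clause nonempty.
open Classical in
theorem monotoneSize_hazardDerivative_le {f : BoolFun n} {m : ℕ} (hf : NoLargeCube f m)
    (hm : m ≤ n) (x : Fin n → Bool) :
    monotoneSize (hazardDerivative f x)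
      ≤ (n * (Finset.univ.filter fun S : Finset (Fin n) => S.card < m).card : ℕ) := by
  set K := Finset.univ.filter fun S : Finset (Fin n) =>
    ∀ z, (∀ i, i ∉ S → z i = x i) → f z = f x with hK
  have hKm : ∀ S ∈ K, S.card < m := by
    intro S hS
    by_contra! h
    obtain ⟨z, hz, hz'⟩ := hf x S h
    exact hz' ((Finset.mem_filter.1 hS).2 z hz)
  have hKne : K.Nonempty := ⟨∅, by
    simp only [hK, Finset.mem_filter, Finset.mem_univ, true_and]
    intro z hz
    rw [show z = x from funext fun i => hz i (by simp)]⟩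
  have clause : ∀ S : Finset (Fin n), ∃ G : Formula n, S ∈ K →
      G.size ≤ n ∧ G.IsMonotone ∧ ∀ w, (G.eval w = some true ↔ ∃ i ∉ S, w i = some true) ∧
        (G.eval w = some false ↔ ∀ i ∉ S, w i = some false) := by
    intro S
    have hc : Sᶜ.Nonempty ∨ S ∉ K := by
      by_cases hS : S ∈ K
      · left
        rw [← Finset.card_pos, Finset.card_compl, Fintype.card_fin]
        have := hKm S hS
        omega
      · exact Or.inr hS
    rcases hc with hc | hS
    · obtain ⟨G, h1, h2, h3⟩ := Formula.exists_sup Sᶜ hc Formula.var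
      refine ⟨G, fun _ => ⟨?_, h2 fun i _ => trivial, fun w => ?_⟩⟩
      · rw [h1]
        simpa [Formula.size] using Sᶜ.card_le_univ
      · simpa [Formula.eval] using h3 w
    · have h0 : 0 < n := by
        obtain ⟨S', hS'⟩ := hKne
        have := hKm S' hS'
        omega
      exact ⟨Formula.var ⟨0, h0⟩, fun h => absurd h hS⟩
  choose G hG using clause
  obtain ⟨H, h1, h2, h3⟩ := Formula.exists_inf K hKne G
  have hH : H.Computes (hazardDerivative f x) := by
    intro y
    rcases hd : hazardDerivative f x y with _ | _
    · rw [hazardDerivative_eq_false] at hd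
      -- The falsified clause is that of the support of `y`.
      refine (h3 _).2.2 ⟨Finset.univ.filter fun i => y i = true, ?_, ?_⟩
      · simpa [hK] using hd
      · refine (((hG _ ?_).2.2 _).2).2 ?_
        · simpa [hK] using hd
        · simp [stable]
    · refine (h3 _).1.2 fun S hS => (((hG S hS).2.2 _).1).2 ?_
      by_contra! h
      rw [← Bool.not_eq_false, hazardDerivative_eq_false] at hd
      refine hd fun z hz => (Finset.mem_filter.1 hS).2 z fun i hi => hz i ?_
      simpa [stable] using h i hi
  refine (iInf₂_le H ⟨hH, h2 fun S hS => (hG S hS).2.1⟩).trans ?_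
  rw [h1, Nat.cast_le]
  calc ∑ S ∈ K, (G S).size ≤ ∑ _S ∈ K, n := Finset.sum_le_sum fun S hS => (hG S hS).1
    _ = n * K.card := by simp [mul_comm]
    _ ≤ _ := Nat.mul_le_mul_left _ (Finset.card_le_card fun S hS => by simpa using hKm S hS)

theorem derivativeSum_le {f : BoolFun n} {m : ℕ} (hf : NoLargeCube f m) (hm : m ≤ n)
    (X : Finset (Fin n → Bool)) :
    derivativeSum f X ≤
      (2 ^ n * (n * (Finset.univ.filter fun S : Finset (Fin n) => S.card < m).card) : ℕ) := by
  have h := Finset.sum_le_card_nsmul X _ _ fun x _ => monotoneSize_hazardDerivative_le hf hm x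
  refine h.trans ?_
  rw [nsmul_eq_mul]
  norm_cast
  gcongr
  · simpa using X.card_le_univ

/-- Weight each set by `q ^ |S|` with `q = k / n ≤ 1`: the total is `(1 + q) ^ n ≤ e ^ k`, and every
set of at most `k` elements weighs at least `q ^ k`. -/
theorem card_small_subsets_le {k : ℕ} (hk : 0 < k) (hkn : k ≤ n) :
    ((Finset.univ.filter fun S : Finset (Fin n) => S.card < k + 1).card : ℝ)
      ≤ (Real.exp 1 * n / k) ^ k := by
  have hk' : (0 : ℝ) < k := by exact_mod_cast hk
  have hn' : (0 : ℝ) < n := by exact_mod_cast hk.trans_le hkn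
  set q : ℝ := k / n with hq
  have hq0 : 0 < q := by positivity
  have hq1 : q ≤ 1 := by
    rw [hq, div_le_one hn']
    exact_mod_cast hkn
  have h1 : ((Finset.univ.filter fun S : Finset (Fin n) => S.card < k + 1).card : ℝ) * q ^ k
      ≤ (q + 1) ^ n := by
    rw [← Fin.sum_pow_mul_eq_add_pow, ← nsmul_eq_mul]
    refine (Finset.card_nsmul_le_sum _ (fun S : Finset (Fin n) => q ^ S.card * 1 ^ (n - S.card)) _
      fun S hS => ?_).trans (Finset.sum_le_univ_sum_of_nonneg fun S => by positivity)
    rw [one_pow, mul_one]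
    exact pow_le_pow_of_le_one hq0.le hq1 (Nat.lt_succ_iff.1 (Finset.mem_filter.1 hS).2)
  have h2 : (q + 1) ^ n ≤ Real.exp 1 ^ k := by
    calc (q + 1) ^ n ≤ Real.exp q ^ n := by
          gcongr
          exact Real.add_one_le_exp q
      _ = Real.exp 1 ^ k := by
          rw [← Real.exp_nat_mul, ← Real.exp_nat_mul]
          congr 1
          rw [hq]
          field_simp
  have h3 : (Real.exp 1 * n / k) ^ k = Real.exp 1 ^ k / q ^ k := by
    rw [← div_pow, hq]
    congr 1
    field_simp
  rw [h3, le_div_iff₀ (by positivity)]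
  exact h1.trans h2

end Derivatives

/-! ### Asymptotics -/

theorem tendsto_logb_pow_div (k : ℕ) :
    Tendsto (fun x : ℝ => Real.logb 2 x ^ k / x) atTop (𝓝 0) := by
  have h := (Real.isLittleO_pow_log_id_atTop (n := k)).tendsto_div_nhds_zero.div_const
    (Real.log 2 ^ k)
  rw [zero_div] at h
  refine h.congr fun x => ?_
  simp only [Real.logb, div_pow, id]
  rw [div_right_comm]

theorem le_clog_two {n : ℕ} (hn : 0 < n) : Real.logb 2 n ≤ Nat.clog 2 n := by
  rw [Real.logb_le_iff_le_rpow one_lt_two (by exact_mod_cast hn), Real.rpow_natCast]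
  exact_mod_cast Nat.le_pow_clog one_lt_two n

theorem clog_two_le {n : ℕ} (hn : 1 < n) : (Nat.clog 2 n : ℝ) ≤ Real.logb 2 n + 1 := by
  have h := Nat.pow_pred_clog_lt_self one_lt_two hn
  have h1 : ((Nat.clog 2 n).pred : ℝ) ≤ Real.logb 2 n := by
    rw [Real.le_logb_iff_rpow_le one_lt_two (by exact_mod_cast (by omega : 0 < n)),
      Real.rpow_natCast]
    exact_mod_cast h.le
  have h2 : Nat.clog 2 n ≤ (Nat.clog 2 n).pred + 1 := by
    rw [Nat.pred_eq_sub_one]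
    omega
  have h3 : (Nat.clog 2 n : ℝ) ≤ (Nat.clog 2 n).pred + 1 := by exact_mod_cast h2
  linarith

theorem eventually_clog_add_two_le : ∀ᶠ n : ℕ in atTop, Nat.clog 2 n + 2 ≤ n := by
  have h := ((tendsto_logb_pow_div 1).comp tendsto_natCast_atTop_atTop).eventually_le_const
    (show (0 : ℝ) < 1 / 2 by norm_num)
  filter_upwards [h, eventually_ge_atTop 6] with n hn h6
  have h6' : (6 : ℝ) ≤ n := by exact_mod_cast h6
  simp only [Function.comp, pow_one] at hn
  rw [div_le_iff₀ (by linarith)] at hn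
  have := clog_two_le (n := n) (by omega)
  have h1 : (Nat.clog 2 n + 2 : ℝ) ≤ n := by linarith
  exact_mod_cast h1

/-- With `L ≤ k ≤ L + 2` and `e < 4`, the numerator `(e * n) ^ k` is at most `4 ^ L * 16 * n ^ 2 * n
^ L`, and `4 ^ L = n ^ 2`. The clause length gives another `n`, and `16 ≤ n` the sixth. -/
theorem mul_card_small_subsets_le {n : ℕ} (hn : 16 ≤ n) (hm : Nat.clog 2 n + 2 ≤ n) :
    (n : ℝ) * (Finset.univ.filter fun S : Finset (Fin n) => S.card < Nat.clog 2 n + 2).card ≤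
      n ^ 6 * ((n : ℝ) ^ Real.logb 2 n / Real.logb 2 n ^ Real.logb 2 n) := by
  have hn0 : (16 : ℝ) ≤ n := by exact_mod_cast hn
  have hle := le_clog_two (n := n) (by omega)
  have hge := clog_two_le (n := n) (by omega)
  have hL1 : 1 ≤ Real.logb 2 n := by
    rw [Real.le_logb_iff_rpow_le one_lt_two (by linarith), Real.rpow_one]
    linarith
  have h2L := rpow_logb_natCast (n := n) (by omega)
  set L := Real.logb 2 n with hL
  have hcard := card_small_subsets_le (n := n) (k := Nat.clog 2 n + 1) (by omega) (by omega)
  set k := Nat.clog 2 n + 1 with hk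
  have hkL : L ≤ k := by rw [hk]; push_cast; linarith
  have hkL' : (k : ℝ) ≤ L + 2 := by rw [hk]; push_cast; linarith
  have hk1 : (1 : ℝ) ≤ k := hL1.trans hkL
  have hLL : L ^ L ≤ (k : ℝ) ^ k := by
    rw [← Real.rpow_natCast]
    exact (Real.rpow_le_rpow (by linarith) hkL (by linarith)).trans
      (Real.rpow_le_rpow_of_exponent_le hk1 hkL)
  have hLL0 : 0 < L ^ L := Real.rpow_pos_of_pos (by linarith) _
  have hnum : (Real.exp 1 * n) ^ k ≤ 16 * n ^ 4 * (n : ℝ) ^ L := by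
    calc (Real.exp 1 * n) ^ k ≤ (4 * n : ℝ) ^ k := by
          gcongr
          exact Real.exp_one_lt_d9.le.trans (by norm_num)
      _ = (4 * n : ℝ) ^ (k : ℝ) := (Real.rpow_natCast _ _).symm
      _ ≤ (4 * n : ℝ) ^ (L + 2) := Real.rpow_le_rpow_of_exponent_le (by linarith) hkL'
      _ = ((2 : ℝ) ^ L) ^ 2 * 16 * n ^ 2 * (n : ℝ) ^ L := by
          rw [Real.rpow_add (by linarith), Real.mul_rpow (by norm_num) (by linarith),
            show (4 : ℝ) = 2 * 2 by norm_num, Real.mul_rpow two_pos.le two_pos.le, Real.rpow_two]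
          ring
      _ = 16 * n ^ 4 * (n : ℝ) ^ L := by
          rw [h2L]
          ring
  have hnL : 0 ≤ (n : ℝ) ^ L := Real.rpow_nonneg (by linarith) _
  calc (n : ℝ) * (Finset.univ.filter fun S : Finset (Fin n) => S.card < k + 1).card
      ≤ n * (Real.exp 1 * n / k) ^ k := by gcongr
    _ = n * ((Real.exp 1 * n) ^ k / (k : ℝ) ^ k) := by rw [div_pow]
    _ ≤ n * (16 * n ^ 4 * (n : ℝ) ^ L / L ^ L) := by gcongr
    _ = 16 * (n ^ 5 * ((n : ℝ) ^ L / L ^ L)) := by ring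
    _ ≤ n * (n ^ 5 * ((n : ℝ) ^ L / L ^ L)) := by gcongr
    _ = _ := by ring

theorem whp_derivativeSum_le :
    WithHighProbability fun n f => (∃ y, f y = false) ∧ ∀ X : Finset (Fin n → Bool),
      (derivativeSum f X : ℝ≥0∞) ≤ ENNReal.ofReal
        (2 ^ n * (n ^ 6 * ((n : ℝ) ^ Real.logb 2 n / Real.logb 2 n ^ Real.logb 2 n))) := by
  refine whp_noLargeCube.mono ?_
  filter_upwards [eventually_clog_add_two_le, eventually_ge_atTop 16] with n hm hn f hf
  refine ⟨hf.exists_eq_false hm, fun X => ?_⟩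
  refine (ENat.toENNReal_mono (derivativeSum_le hf hm X)).trans ?_
  rw [ENat.toENNReal_coe, ← ENNReal.ofReal_natCast]
  refine ENNReal.ofReal_le_ofReal ?_
  have := mul_card_small_subsets_le hn hm
  push_cast
  gcongr

theorem whp_hazardFreeSize_le :
    WithHighProbability fun n f => (hazardFreeSize f : ℝ≥0∞) ≤ ENNReal.ofReal
      (2 ^ n * (n ^ 6 * ((n : ℝ) ^ Real.logb 2 n / Real.logb 2 n ^ Real.logb 2 n))) :=
  whp_derivativeSum_le.mono <| Eventually.of_forall fun _ f hf =>
    (ENat.toENNReal_mono (hazardFreeSize_le_derivativeSum (covers_univ f) hf.1)).trans (hf.2 _)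

/-- With `l = log L`, one has `L ^ (6 / l * L) = 2 ^ (6 * L) = n ^ 6`; the polynomial factor
therefore only perturbs the exponent of `L`. -/
theorem pow_mul_div_logb_rpow {n : ℕ} (hn : 0 < n) (hL : 1 < Real.logb 2 n) :
    (n : ℝ) ^ 6 * ((n : ℝ) ^ Real.logb 2 n / Real.logb 2 n ^ Real.logb 2 n) =
      (n : ℝ) ^ Real.logb 2 n /
        Real.logb 2 n ^ ((1 - 6 / Real.logb 2 (Real.logb 2 n)) * Real.logb 2 n) := by
  have h2L := rpow_logb_natCast hn
  set L := Real.logb 2 n with hLdef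
  have hL0 : 0 < L := by linarith
  have hl : 0 < Real.logb 2 L := Real.logb_pos one_lt_two hL
  have h2l : (2 : ℝ) ^ Real.logb 2 L = L := Real.rpow_logb two_pos (by norm_num) hL0
  set l := Real.logb 2 L with hl_def
  have h6 : L ^ (6 / l * L) = (n : ℝ) ^ 6 := by
    rw [← h2l, ← Real.rpow_mul two_pos.le, h2l, ← h2L, ← Real.rpow_natCast,
      ← Real.rpow_mul two_pos.le]
    congr 1
    push_cast
    field_simp
  rw [sub_mul, one_mul, Real.rpow_sub hL0, h6]
  have := Real.rpow_pos_of_pos hL0 L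
  have hn' : (0 : ℝ) < n := by exact_mod_cast hn
  field_simp

theorem rpow_div_logb_rpow {n : ℕ} (hn : 0 < n) (hL : 1 < Real.logb 2 n) (c : ℝ) :
    (n : ℝ) ^ Real.logb 2 n / Real.logb 2 n ^ (c * Real.logb 2 n) =
      (n : ℝ) ^ ((1 - c * (Real.logb 2 (Real.logb 2 n) / Real.logb 2 n)) * Real.logb 2 n) := by
  have h2L := rpow_logb_natCast hn
  have hn' : (0 : ℝ) < n := by exact_mod_cast hn
  set L := Real.logb 2 n with hLdef
  have hL0 : 0 < L := by linarith
  have h2l : (2 : ℝ) ^ Real.logb 2 L = L := Real.rpow_logb two_pos (by norm_num) hL0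
  set l := Real.logb 2 L with hl_def
  have h : (n : ℝ) ^ (c * (l / L) * L) = L ^ (c * L) := by
    rw [← h2L, ← Real.rpow_mul two_pos.le]
    nth_rewrite 4 [← h2l]
    rw [← Real.rpow_mul two_pos.le]
    congr 1
    field_simp
  rw [sub_mul, one_mul, Real.rpow_sub hn', h]

theorem two_pow_mul_le_rpow {n : ℕ} (hn : 0 < n) (hL : 1 ≤ Real.logb 2 n) :
    2 ^ n * ((n : ℝ) ^ 6 * ((n : ℝ) ^ Real.logb 2 n / Real.logb 2 n ^ Real.logb 2 n)) ≤
      (2 : ℝ) ^ ((1 + (Real.logb 2 n ^ 2 + 6 * Real.logb 2 n) / n) * n) := by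
  have h2L := rpow_logb_natCast hn
  have hn' : (0 : ℝ) < n := by exact_mod_cast hn
  set L := Real.logb 2 n with hLdef
  have h1 : (1 : ℝ) ≤ L ^ L := Real.one_le_rpow hL (by linarith)
  have h2 : (n : ℝ) ^ L / L ^ L ≤ (n : ℝ) ^ L :=
    div_le_self (Real.rpow_nonneg hn'.le _) h1
  calc _ ≤ 2 ^ n * ((n : ℝ) ^ 6 * (n : ℝ) ^ L) := by gcongr
    _ = (2 : ℝ) ^ (n : ℝ) * (((2 : ℝ) ^ L) ^ (6 : ℝ) * ((2 : ℝ) ^ L) ^ L) := by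
        rw [h2L, Real.rpow_natCast]
        norm_cast
    _ = _ := by
        rw [← Real.rpow_mul two_pos.le, ← Real.rpow_mul two_pos.le, ← Real.rpow_add two_pos,
          ← Real.rpow_add two_pos]
        congr 1
        field_simp
        ring

/-- The error term of the upper bound is reused for a common `δ`; it suffices since `L ^ 2 + 6 * L ≥
L + 1` and `L ≤ n = 2 ^ L`. -/
theorem rpow_le_two_pow_div {n : ℕ} (hn : 0 < n) (hL : 1 ≤ Real.logb 2 n) :
    (2 : ℝ) ^ ((1 - (Real.logb 2 n ^ 2 + 6 * Real.logb 2 n) / n) * n) ≤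
      (1 - 1 / 2) * 2 ^ n / Real.logb 2 n := by
  have h2L := rpow_logb_natCast hn
  have hLn := logb_natCast_le n
  have hn' : (0 : ℝ) < n := by exact_mod_cast hn
  set L := Real.logb 2 n with hLdef
  rw [le_div_iff₀ (by linarith)]
  calc (2 : ℝ) ^ ((1 - (L ^ 2 + 6 * L) / n) * n) * L
      ≤ (2 : ℝ) ^ (n - L - 1) * L := by
        gcongr
        · exact one_le_two
        · field_simp
          nlinarith
    _ ≤ (2 : ℝ) ^ (n - L - 1) * n := by gcongr
    _ = (2 : ℝ) ^ (n - L - 1) * 2 ^ L := by rw [h2L]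
    _ = (2 : ℝ) ^ ((n : ℝ) - 1) := by
        rw [← Real.rpow_add two_pos]
        congr 1
        ring
    _ = (1 - 1 / 2) * 2 ^ n := by
        rw [Real.rpow_sub two_pos, Real.rpow_natCast, Real.rpow_one]
        ring

theorem tendsto_logb_sq_add_div :
    Tendsto (fun n : ℕ => (Real.logb 2 n ^ 2 + 6 * Real.logb 2 n) / n) atTop (𝓝 0) := by
  have h := ((tendsto_logb_pow_div 2).add ((tendsto_logb_pow_div 1).const_mul 6)).comp
    (tendsto_natCast_atTop_atTop (R := ℝ))
  rw [mul_zero, add_zero] at h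
  refine h.congr fun n => ?_
  simp only [Function.comp]
  ring

theorem tendsto_six_div_logb_logb :
    Tendsto (fun n : ℕ => 6 / Real.logb 2 (Real.logb 2 n)) atTop (𝓝 0) :=
  tendsto_const_nhds.div_atTop
    ((Real.tendsto_logb_atTop one_lt_two).comp tendsto_logb_natCast)

/-- `(1 + d) * (1 - 2 * d) = 1 - d - 2 * d ^ 2 ≤ 1 - d`; the exponent must be nonnegative to
preserve the inequality. -/
theorem rpow_le_of_two_rpow_bounds {s t : ℝ≥0∞} {d n : ℝ} (hn : 0 ≤ n) (hd : 2 * d ≤ 1)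
    (ht : t ≤ ENNReal.ofReal ((2 : ℝ) ^ ((1 + d) * n)))
    (hs : ENNReal.ofReal ((2 : ℝ) ^ ((1 - d) * n)) ≤ s) : t ^ (1 - 2 * d) ≤ s := by
  refine (ENNReal.rpow_le_rpow ht (by linarith)).trans (le_trans ?_ hs)
  rw [ENNReal.ofReal_rpow_of_pos (by positivity), ← Real.rpow_mul two_pos.le]
  refine ENNReal.ofReal_le_ofReal (Real.rpow_le_rpow_of_exponent_le one_le_two ?_)
  nlinarith [mul_nonneg hn (sq_nonneg d)]

theorem whp_hazardFreeSize_ge_rpow :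
    WithHighProbability fun n f =>
      ENNReal.ofReal ((2 : ℝ) ^ ((1 - (Real.logb 2 n ^ 2 + 6 * Real.logb 2 n) / n) * n))
        ≤ (hazardFreeSize f : ℝ≥0∞) := by
  refine (whp_hazardFreeSize_ge (ε := 1 / 2) (by norm_num)).mono ?_
  filter_upwards [eventually_gt_atTop 0, tendsto_logb_natCast.eventually_ge_atTop 1]
    with n hn hL f hf
  exact (ENNReal.ofReal_le_ofReal (rpow_le_two_pow_div hn hL)).trans hf

theorem whp_derivativeSum_le_rpow :
    WithHighProbability fun n f => (∃ y, f y = false) ∧ ∀ X : Finset (Fin n → Bool),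
      (derivativeSum f X : ℝ≥0∞) ≤ ENNReal.ofReal
        ((2 : ℝ) ^ ((1 + (Real.logb 2 n ^ 2 + 6 * Real.logb 2 n) / n) * n)) := by
  refine whp_derivativeSum_le.mono ?_
  filter_upwards [eventually_gt_atTop 0, tendsto_logb_natCast.eventually_ge_atTop 1]
    with n hn hL f hf
  exact ⟨hf.1, fun X => (hf.2 X).trans (ENNReal.ofReal_le_ofReal (two_pow_mul_le_rpow hn hL))⟩

end HazardFree

theorem theorem1p15 :
    -- lower bound: (1 - o(1)) * 2^n / log n
    (∀ ε : ℝ, 0 < ε →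
      HazardFree.WithHighProbability fun n f =>
        ENNReal.ofReal ((1 - ε) * 2 ^ n / Real.logb 2 n)
          ≤ (HazardFree.hazardFreeSize f : ℝ≥0∞)) ∧
    -- upper bound: 2^n * n^((1 - o(1)) * log n)
    (∃ δ : ℕ → ℝ, (∀ n, 0 ≤ δ n) ∧ Tendsto δ atTop (𝓝 0) ∧
      HazardFree.WithHighProbability fun n f =>
        (HazardFree.hazardFreeSize f : ℝ≥0∞)
          ≤ ENNReal.ofReal (2 ^ n * (n : ℝ) ^ ((1 - δ n) * Real.logb 2 n))) ∧
    -- sharper upper bound: 2^n * n^(log n) / (log n)^((1 - o(1)) * log n)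
    (∃ δ : ℕ → ℝ, Tendsto δ atTop (𝓝 0) ∧
      HazardFree.WithHighProbability fun n f =>
        (HazardFree.hazardFreeSize f : ℝ≥0∞)
          ≤ ENNReal.ofReal (2 ^ n * ((n : ℝ) ^ Real.logb 2 n /
              Real.logb 2 n ^ ((1 - δ n) * Real.logb 2 n)))) ∧
    -- the size is 2^((1 + o(1)) * n)
    (∃ δ : ℕ → ℝ, Tendsto δ atTop (𝓝 0) ∧
      HazardFree.WithHighProbability fun n f =>
        ENNReal.ofReal ((2 : ℝ) ^ ((1 - δ n) * n)) ≤ (HazardFree.hazardFreeSize f : ℝ≥0∞) ∧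
        (HazardFree.hazardFreeSize f : ℝ≥0∞) ≤ ENNReal.ofReal ((2 : ℝ) ^ ((1 + δ n) * n))) ∧
    -- the sum over a minimum covering set is tight up to the exponent 1 - o(1)
    (∃ δ : ℕ → ℝ, Tendsto δ atTop (𝓝 0) ∧
      HazardFree.WithHighProbability fun n f =>
        ∀ X : Finset (Fin n → Bool), HazardFree.IsMinimumCover f X →
          (HazardFree.derivativeSum f X : ℝ≥0∞) ^ (1 - δ n)
            ≤ (HazardFree.hazardFreeSize f : ℝ≥0∞) ∧
          HazardFree.hazardFreeSize f ≤ HazardFree.derivativeSum f X) := by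
  refine ⟨fun ε hε => HazardFree.whp_hazardFreeSize_ge hε,
    -- This rewrites the sharper bound as a power of `n`; the `max` only matters for small `n`,
    -- where the expression may be negative.
    ⟨fun n => max 0 ((1 - 6 / Real.logb 2 (Real.logb 2 n)) *
      (Real.logb 2 (Real.logb 2 n) / Real.logb 2 n)), fun n => le_max_left _ _, ?_, ?_⟩,
    ⟨fun n => 6 / Real.logb 2 (Real.logb 2 n), HazardFree.tendsto_six_div_logb_logb, ?_⟩,
    ⟨fun n => (Real.logb 2 n ^ 2 + 6 * Real.logb 2 n) / n,
      HazardFree.tendsto_logb_sq_add_div, ?_⟩,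
    ⟨fun n => 2 * ((Real.logb 2 n ^ 2 + 6 * Real.logb 2 n) / n), ?_, ?_⟩⟩
  · have h := (HazardFree.tendsto_logb_pow_div 1).comp HazardFree.tendsto_logb_natCast
    have h' := (HazardFree.tendsto_six_div_logb_logb.const_sub 1).mul h
    rw [mul_zero] at h'
    simpa using (tendsto_const_nhds (x := (0 : ℝ))).max h'
  · refine HazardFree.whp_hazardFreeSize_le.mono ?_
    filter_upwards [eventually_gt_atTop 0, HazardFree.tendsto_logb_natCast.eventually_gt_atTop 1,
      HazardFree.tendsto_six_div_logb_logb.eventually_le_const one_pos] with n hn hL h6 f hf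
    rwa [max_eq_right, ← HazardFree.rpow_div_logb_rpow hn hL,
      ← HazardFree.pow_mul_div_logb_rpow hn hL]
    exact mul_nonneg (by linarith)
      (div_nonneg (Real.logb_nonneg one_lt_two hL.le) (by linarith))
  · refine HazardFree.whp_hazardFreeSize_le.mono ?_
    filter_upwards [eventually_gt_atTop 0, HazardFree.tendsto_logb_natCast.eventually_gt_atTop 1]
      with n hn hL f hf
    rwa [← HazardFree.pow_mul_div_logb_rpow hn hL]
  · refine (HazardFree.whp_hazardFreeSize_ge_rpow.and HazardFree.whp_derivativeSum_le_rpow).mono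
      (Eventually.of_forall fun n f hf => ⟨hf.1, ?_⟩)
    exact (ENat.toENNReal_mono (HazardFree.hazardFreeSize_le_derivativeSum
      (HazardFree.covers_univ f) hf.2.1)).trans (hf.2.2 _)
  · simpa using HazardFree.tendsto_logb_sq_add_div.const_mul 2
  · refine (HazardFree.whp_hazardFreeSize_ge_rpow.and HazardFree.whp_derivativeSum_le_rpow).mono ?_
    filter_upwards [HazardFree.tendsto_logb_sq_add_div.eventually_le_const
      (show (0 : ℝ) < 1 / 2 by norm_num)] with n hd f hf X hX
    exact ⟨HazardFree.rpow_le_of_two_rpow_bounds n.cast_nonneg (by linarith) (hf.2.2 X) hf.1,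
      HazardFree.hazardFreeSize_le_derivativeSum hX.1 hf.2.1⟩
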